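/- Work in continuous first order logic. Let $\mathcal L$ be a (possibly many-sorted) metric continuous signature, fix a full system of continuous connectives, and let $T$ be an $\mathcal L$-theory (not necessarily complete). Let $\varphi(x,y)$ be an $\mathcal L$-formula, where $x$ and $y$ are disjoint finite tuples of variables, and write $\tilde\varphi(y,x):=\varphi(x,y)$. Assume that $\varphi$ is stable in $T$: for every $\varepsilon>0$ there are no model $N\models T$ and sequence $(a_i,b_i)_{i<\omega}$ in $N$ with $|\varphi^N(a_i,b_j)-\varphi^N(a_j,b_i)|\ge\varepsilon$ for all $i<j$. For $M\models T$ let $S_x(M)$ be the space of complete types over $M$ in the variables $x$, with the logic topology. Let $S_\varphi(M)$ be the quotient space of $S_x(M)$ obtained by identifying types that assign the same value to $\varphi(x,b)$ for every tuple $b$ in $M$; for $p\in S_\varphi(M)$ write $\varphi(x,b)^p$ for this value. Define $S_y(M)$ and $S_{\tilde\varphi}(M)$ in the same way. An $M$-definable predicate in $y$ is a continuous function $\psi\colon S_y(M)\to[0,1]$, with $\psi^M(b):=\psi(\operatorname{tp}(b/M))$; it is a $\tilde\varphi$-predicate over $M$ if it factors through a continuous function $S_{\tilde\varphi}(M)\to[0,1]$,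 whose value at $q\in S_{\tilde\varphi}(M)$ is denoted $\psi(y)^q$. A definition of $p\in S_\varphi(M)$ is an $M$-definable predicate $\psi(y)$ such that $\varphi(x,b)^p=\psi^M(b)$ for every tuple $b$ in $M$. Exchange the roles of $x$ and $y$ for $q\in S_{\tilde\varphi}(M)$. Let $M\models T$, $p\in S_\varphi(M)$ and $q\in S_{\tilde\varphi}(M)$. Then $p$ has a unique definition $d_p\varphi(y)$, which is a $\tilde\varphi$-predicate over $M$; $q$ has a unique definition $d_q\tilde\varphi(x)$, which is a $\varphi$-predicate over $M$; and $$d_p\varphi(y)^q=d_q\tilde\varphi(x)^p .$$ -/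

import Mathlib

universe u w w'

namespace ContLogic

/-! ### Signatures and structures -/

/-- A (metric, many-sorted) continuous signature. Besides the predicate symbols in `Rel`, each sort
has its distinguished binary distance symbol (see `PredSym`). Every symbol carries a continuity
modulus `(0,∞) → (0,∞)` for each of its arguments. -/
structure Signature where
  /-- sorts -/
  Srt : Type u
  /-- function symbols -/
  Func : Type u
  /-- predicate symbols other than the distance symbols -/
  Rel : Type u
  funcArity : Func → ℕ
  funcDom : ∀ f, Fin (funcArity f) → Srt
  funcCod : Func → Srt
  relArity : Rel → ℕ
  relDom : ∀ P, Fin (relArity P) → Srt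
  funcModulus : ∀ f, Fin (funcArity f) → Set.Ioi (0 : ℝ) → Set.Ioi (0 : ℝ)
  relModulus : ∀ P, Fin (relArity P) → Set.Ioi (0 : ℝ) → Set.Ioi (0 : ℝ)
  distModulus : Srt → Fin 2 → Set.Ioi (0 : ℝ) → Set.Ioi (0 : ℝ)

/-- All predicate symbols of a signature: the distance symbol of each sort, and the others. -/
inductive PredSym (L : Signature.{u}) : Type u
  | dist (s : L.Srt) : PredSym L
  | rel (P : L.Rel) : PredSym L

namespace PredSym

variable {L : Signature.{u}}

def arity : PredSym L → ℕ
  | dist _ => 2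
  | rel P => L.relArity P

def dom : (P : PredSym L) → Fin P.arity → L.Srt
  | dist s => fun _ => s
  | rel P => L.relDom P

def modulus : (P : PredSym L) → Fin P.arity → Set.Ioi (0 : ℝ) → Set.Ioi (0 : ℝ)
  | dist s => L.distModulus s
  | rel P => L.relModulus P

end PredSym

/-- Interpretations of the symbols of `L`: nonempty sorts, functions, and `[0,1]`-valued
predicates. -/
structure Interp (L : Signature.{u}) where
  carrier : L.Srt → Type u
  nonempty : ∀ s, Nonempty (carrier s)
  func : ∀ f : L.Func, (∀ i, carrier (L.funcDom f i)) → carrier (L.funcCod f)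
  pred : ∀ P : PredSym L, (∀ i, carrier (P.dom i)) → unitInterval

/-- The interpretation of the distance symbol of the sort `s`, as a real-valued function. -/
def Interp.d {L : Signature.{u}} (M : Interp L) (s : L.Srt) (a b : M.carrier s) : ℝ :=
  (M.pred (PredSym.dist s) (fun i : Fin 2 => if i = 0 then a else b) : ℝ)

/-- A continuous `L`-pre-structure: the pseudo-metric axioms and the uniform continuity axioms
hold. -/
structure PreStruct (L : Signature.{u}) extends Interp L where
  d_self : ∀ s a, toInterp.d s a a = 0
  d_symm : ∀ s a b, toInterp.d s a b = toInterp.d s b a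
  d_triangle : ∀ s a b c, toInterp.d s a b ≤ toInterp.d s a c + toInterp.d s c b
  uc_func : ∀ (f : L.Func) (i : Fin (L.funcArity f)) (ε : Set.Ioi (0 : ℝ))
    (a : ∀ j, carrier (L.funcDom f j)) (z w : carrier (L.funcDom f i)),
    toInterp.d _ z w < (L.funcModulus f i ε : ℝ) →
      toInterp.d _ (func f (Function.update a i z)) (func f (Function.update a i w)) ≤ ε
  uc_pred : ∀ (P : PredSym L) (i : Fin P.arity) (ε : Set.Ioi (0 : ℝ))
    (a : ∀ j, carrier (P.dom j)) (z w : carrier (P.dom i)),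
    toInterp.d _ z w < (P.modulus i ε : ℝ) →
      |(pred P (Function.update a i z) : ℝ) - (pred P (Function.update a i w) : ℝ)| ≤ ε

/-- A continuous `L`-structure: a pre-structure in which every distance is a complete metric. -/
structure Struct (L : Signature.{u}) extends PreStruct L where
  eq_of_d_eq_zero : ∀ s a b, toInterp.d s a b = 0 → a = b
  complete : ∀ s (c : ℕ → carrier s),
    (∀ ε > 0, ∃ N, ∀ m ≥ N, ∀ n ≥ N, toInterp.d s (c m) (c n) < ε) →
      ∃ l, ∀ ε > 0, ∃ N, ∀ n ≥ N, toInterp.d s (c n) l < ε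

/-! ### Connectives -/

/-- A system of continuous connectives: for each `n`, a set of continuous maps `[0,1]^n → [0,1]`. -/
abbrev ConnectiveSystem := ∀ n : ℕ, Set C(Fin n → unitInterval, unitInterval)

namespace ConnectiveSystem

/-- Membership in the closed system generated by `F` (projections and compositions). -/
inductive Generates (F : ConnectiveSystem) :
    ∀ n : ℕ, C(Fin n → unitInterval, unitInterval) → Prop
  | base {n : ℕ} {c : C(Fin n → unitInterval, unitInterval)} (hc : c ∈ F n) : Generates F n c
  | proj {n : ℕ} (i : Fin n) : Generates F n ⟨fun t => t i, continuous_apply i⟩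
  | comp {n m : ℕ} {c : C(Fin n → unitInterval, unitInterval)}
      {g : Fin n → C(Fin m → unitInterval, unitInterval)}
      (hc : Generates F n c) (hg : ∀ i, Generates F m (g i)) :
      Generates F m (c.comp (ContinuousMap.pi g))

/-- `F` is full: for `n > 0` the `n`-ary connectives generated by `F` are uniformly dense. -/
def IsFull (F : ConnectiveSystem) : Prop :=
  ∀ n : ℕ, 0 < n → Dense {c : C(Fin n → unitInterval, unitInterval) | F.Generates n c}

end ConnectiveSystem

/-! ### Terms and formulae

Free variables form a family of types `V` indexed by the sorts (`V s` is the type of free variables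
of sort `s`); bound variables are positions in a list of sorts. -/

/-- `BVar Γ s`: the positions of the list `Γ` that hold the sort `s`. -/
inductive BVar {S : Type u} : List S → S → Type u
  | zero {Γ : List S} {s : S} : BVar (s :: Γ) s
  | succ {Γ : List S} {s t : S} (v : BVar Γ s) : BVar (t :: Γ) s

inductive Term (L : Signature.{u}) (V : L.Srt → Type w) (Γ : List L.Srt) : L.Srt → Type (max u w)
  | fvar {s : L.Srt} (v : V s) : Term L V Γ s
  | bvar {s : L.Srt} (v : BVar Γ s) : Term L V Γ s
  | app (f : L.Func) (ts : ∀ i, Term L V Γ (L.funcDom f i)) : Term L V Γ (L.funcCod f)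

/-- Continuous first order formulae over the connectives `F`, with free variables in `V` and (not
yet quantified) bound variables in the list. -/
inductive Formula (L : Signature.{u}) (F : ConnectiveSystem) (V : L.Srt → Type w) :
    List L.Srt → Type (max u w)
  | atom {Γ : List L.Srt} (P : PredSym L) (ts : ∀ i, Term L V Γ (P.dom i)) : Formula L F V Γ
  | conn {Γ : List L.Srt} {n : ℕ} (c : C(Fin n → unitInterval, unitInterval)) (hc : c ∈ F n)
      (ψ : Fin n → Formula L F V Γ) : Formula L F V Γ
  | inf {Γ : List L.Srt} (s : L.Srt) (ψ : Formula L F V (s :: Γ)) : Formula L F V Γ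
  | sup {Γ : List L.Srt} (s : L.Srt) (ψ : Formula L F V (s :: Γ)) : Formula L F V Γ

section Semantics

variable {L : Signature.{u}} {F : ConnectiveSystem}

/-- A tuple of elements of `M` indexed by the sorted family of variables `V`. -/
abbrev Tuple (V : L.Srt → Type w) (M : Struct L) : Type (max u w) := ∀ s, V s → M.carrier s

/-- Values of the bound variables. -/
abbrev Env (M : Struct L) (Γ : List L.Srt) : Type u := ∀ s, BVar Γ s → M.carrier s

def Env.nil (M : Struct L) : Env M [] := fun _ v => nomatch v

def Env.cons {M : Struct L} {Γ : List L.Srt} {t : L.Srt} (b : M.carrier t) (e : Env M Γ) :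
    Env M (t :: Γ)
  | _, .zero => b
  | _, .succ v => e _ v

def Term.eval {V : L.Srt → Type w} {Γ : List L.Srt} (M : Struct L) (a : Tuple V M) (e : Env M Γ) :
    {s : L.Srt} → Term L V Γ s → M.carrier s
  | _, .fvar v => a _ v
  | _, .bvar v => e _ v
  | _, .app f ts => M.func f (fun i => (ts i).eval M a e)

/-- The truth value of a formula; `⨅` and `⨆` are taken in the complete lattice `[0,1]`. -/
noncomputable def Formula.eval {V : L.Srt → Type w} (M : Struct L) (a : Tuple V M) :
    {Γ : List L.Srt} → Formula L F V Γ → Env M Γ → unitInterval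
  | _, .atom P ts, e => M.pred P (fun i => (ts i).eval M a e)
  | _, .conn c _ ψ, e => c (fun i => (ψ i).eval M a e)
  | _, .inf _ ψ, e => ⨅ b, ψ.eval M a (Env.cons b e)
  | _, .sup _ ψ, e => ⨆ b, ψ.eval M a (Env.cons b e)

/-- The value `φ^M(a)` of a formula all of whose variables are free variables from `V`. -/
noncomputable def Formula.value {V : L.Srt → Type w} (φ : Formula L F V []) (M : Struct L)
    (a : Tuple V M) : unitInterval :=
  φ.eval M a (Env.nil M)

/-- Sort-preserving renaming of the free variables. -/
def Term.relabel {V : L.Srt → Type w} {W : L.Srt → Type w'} (g : ∀ s, V s → W s)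
    {Γ : List L.Srt} : {s : L.Srt} → Term L V Γ s → Term L W Γ s
  | _, .fvar v => .fvar (g _ v)
  | _, .bvar v => .bvar v
  | _, .app f ts => .app f (fun i => (ts i).relabel g)

/-- Sort-preserving renaming of the free variables. -/
def Formula.relabel {V : L.Srt → Type w} {W : L.Srt → Type w'} (g : ∀ s, V s → W s) :
    {Γ : List L.Srt} → Formula L F V Γ → Formula L F W Γ
  | _, .atom P ts => .atom P (fun i => (ts i).relabel g)
  | _, .conn c hc ψ => .conn c hc (fun i => (ψ i).relabel g)
  | _, .inf s ψ => .inf s (ψ.relabel g)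
  | _, .sup s ψ => .sup s (ψ.relabel g)

end Semantics

/-! ### Theories, elementary extensions -/

/-- A theory: a set of sentences `σ`, standing for the conditions `σ = 0`. -/
abbrev Theory (L : Signature.{u}) (F : ConnectiveSystem) : Type u :=
  Set (Formula L F (fun _ => Empty) [])

def IsModel {L : Signature.{u}} {F : ConnectiveSystem} (M : Struct L) (T : Theory L F) : Prop :=
  ∀ σ ∈ T, σ.value M (fun _ v => v.elim) = 0

/-- Elementary embeddings, exhibiting `N` as an elementary extension of `M`. -/
structure ElemEmbedding {L : Signature.{u}} (F : ConnectiveSystem) (M N : Struct L) where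
  toFun : ∀ s, M.carrier s → N.carrier s
  map_func : ∀ (f : L.Func) (a : ∀ i, M.carrier (L.funcDom f i)),
    toFun _ (M.func f a) = N.func f (fun i => toFun _ (a i))
  map_value : ∀ (V : L.Srt → Type u) (ψ : Formula L F V []) (a : Tuple V M),
    ψ.value N (fun s v => toFun s (a s v)) = ψ.value M a

def ElemEmbedding.refl {L : Signature.{u}} (F : ConnectiveSystem) (M : Struct L) :
    ElemEmbedding F M M where
  toFun _ a := a
  map_func _ _ := rfl
  map_value _ _ _ := rfl

/-! ### Types over a structure, definable predicates -/

/-- The free variables of formulae in the variables `X` with parameters in `M`: the variables, and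
a name for each element of `M`. -/
abbrev VarsAndParams {L : Signature.{u}} (X : L.Srt → Type) (M : Struct L) : L.Srt → Type u :=
  fun s => X s ⊕ M.carrier s

section Types

variable {L : Signature.{u}} {F : ConnectiveSystem}

/-- The type over `M` of a tuple `a` in an elementary extension `N` of `M`, given by the values
of all formulae with parameters in `M`. -/
noncomputable def tpFun {M N : Struct L} (j : ElemEmbedding F M N) {X : L.Srt → Type}
    (a : Tuple X N) : Formula L F (VarsAndParams X M) [] → unitInterval :=
  fun ψ => ψ.value N (fun s => Sum.elim (a s) (j.toFun s))

variable (F) in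
/-- The space of complete types over `M` in the variables `X`. A type `p` is given by its value
assignment `ψ ↦ ψ^p`; it has to be realised in some elementary extension of `M`. -/
def TypeOver (X : L.Srt → Type) (M : Struct L) : Type u :=
  {p : Formula L F (VarsAndParams X M) [] → unitInterval //
    ∃ (N : Struct L) (j : ElemEmbedding F M N) (a : Tuple X N), p = tpFun j a}

/-- The logic topology: the coarsest one for which all `p ↦ ψ^p` are continuous. -/
instance (X : L.Srt → Type) (M : Struct L) : TopologicalSpace (TypeOver F X M) :=
  TopologicalSpace.induced Subtype.val Pi.topologicalSpace

variable (F) in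
/-- The type over `M` of a tuple of `M`. -/
noncomputable def tpSelf {X : L.Srt → Type} {M : Struct L} (a : Tuple X M) : TypeOver F X M :=
  ⟨tpFun (ElemEmbedding.refl F M) a, M, ElemEmbedding.refl F M, a, rfl⟩

variable (F) in
/-- An `M`-definable predicate in the variables `X`: a continuous function from the type space to
`[0,1]`. -/
abbrev DefPredicate (X : L.Srt → Type) (M : Struct L) : Type u :=
  C(TypeOver F X M, unitInterval)

end Types

/-! ### Local types -/

/-- A formula `φ(x, y)` whose free variables are split into two groups `X` and `Y`. -/
abbrev SplitFormula (L : Signature.{u}) (F : ConnectiveSystem) (X Y : L.Srt → Type) : Type u :=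
  Formula L F (fun s => X s ⊕ Y s) []

namespace SplitFormula

variable {L : Signature.{u}} {F : ConnectiveSystem} {X Y : L.Srt → Type}

/-- `φ^M(a, b)`. -/
noncomputable def value₂ (φ : SplitFormula L F X Y) (M : Struct L) (a : Tuple X M)
    (b : Tuple Y M) : unitInterval :=
  Formula.value φ M (fun s => Sum.elim (a s) (b s))

/-- The same formula with the roles of the two groups of variables exchanged. -/
def tilde (φ : SplitFormula L F X Y) : SplitFormula L F Y X :=
  Formula.relabel (fun _ => Sum.swap) φ

/-- The instance `φ(x, b)`, a formula with parameters in `M`. -/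
def inst (φ : SplitFormula L F X Y) {M : Struct L} (b : Tuple Y M) :
    Formula L F (VarsAndParams X M) [] :=
  Formula.relabel (fun s => Sum.map id (b s)) φ

/-- `φ` is `ε`-stable in `T`. -/
def IsEpsStable (T : Theory L F) (φ : SplitFormula L F X Y) (ε : ℝ) : Prop :=
  ∀ M : Struct L, IsModel M T →
    ¬ ∃ (a : ℕ → Tuple X M) (b : ℕ → Tuple Y M), ∀ i j, i < j →
      ε ≤ |(φ.value₂ M (a i) (b j) : ℝ) - (φ.value₂ M (a j) (b i) : ℝ)|

/-- `φ` is stable in `T`. -/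
def IsStable (T : Theory L F) (φ : SplitFormula L F X Y) : Prop :=
  ∀ ε : ℝ, 0 < ε → φ.IsEpsStable T ε

/-- Types over `M` are identified if they agree on all instances `φ(x, b)`. -/
def phiSetoid (φ : SplitFormula L F X Y) (M : Struct L) : Setoid (TypeOver F X M) where
  r p p' := ∀ b : Tuple Y M, p.1 (φ.inst b) = p'.1 (φ.inst b)
  iseqv := ⟨fun _ _ => rfl, fun h b => (h b).symm, fun h h' b => (h b).trans (h' b)⟩

/-- The space of complete `φ`-types over `M`, with the quotient topology. -/
def PhiType (φ : SplitFormula L F X Y) (M : Struct L) : Type u :=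
  Quotient (φ.phiSetoid M)

instance (φ : SplitFormula L F X Y) (M : Struct L) : TopologicalSpace (φ.PhiType M) :=
  inferInstanceAs (TopologicalSpace (Quotient (φ.phiSetoid M)))

/-- The projection from types to `φ`-types. -/
def toPhiType (φ : SplitFormula L F X Y) (M : Struct L) : C(TypeOver F X M, φ.PhiType M) :=
  ⟨Quotient.mk (φ.phiSetoid M), continuous_quotient_mk'⟩

/-- The value `φ(x, b)^p` for a `φ`-type `p`. -/
def PhiType.value {φ : SplitFormula L F X Y} {M : Struct L} (p : φ.PhiType M) (b : Tuple Y M) :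
    unitInterval :=
  Quotient.lift (s := φ.phiSetoid M) (fun r : TypeOver F X M => r.1 (φ.inst b))
    (fun _ _ h => h b) p

/-- A `φ`-predicate over `M`: a continuous function from the space of `φ`-types to `[0,1]`. -/
abbrev PhiPredicate (φ : SplitFormula L F X Y) (M : Struct L) : Type u :=
  C(φ.PhiType M, unitInterval)

/-- A `φ`-predicate over `M`, as an `M`-definable predicate. -/
def PhiPredicate.toDefPredicate {φ : SplitFormula L F X Y} {M : Struct L}
    (θ : φ.PhiPredicate M) : DefPredicate F X M :=
  ContinuousMap.comp θ (φ.toPhiType M)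

/-- `ψ(y)` is a definition of the `φ`-type `p(x)`: `φ(x, b)^p = ψ^M(b)` for all `b` in `M`. -/
def IsDefinition {φ : SplitFormula L F X Y} {M : Struct L} (p : φ.PhiType M)
    (ψ : DefPredicate F Y M) : Prop :=
  ∀ b : Tuple Y M, p.value b = ψ (tpSelf F b)

end SplitFormula

end ContLogic

namespace ContLogic

open Filter Topology

/-! ### Realised types are dense -/

section Density

variable {L : Signature.{u}} {F : ConnectiveSystem}

/-! This is Grothendieck's double limit argument, carried out inside the single model `M`. Types
realised in `M` are dense (`denseRange_tpSelf`), so `p` is a limit of tuples `a` of `M` along an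
ultrafilter `U`, and `q` a limit of tuples `b` along an ultrafilter `V`. Put `d_pφ(q') = lim_U φ(a,
y)^q'`. On realised types this is the definition of `p`, and density makes a definition unique.

Stability forbids the order property in `M`, which forces `lim_U lim_V φ(a, b) = lim_V lim_U φ(a,
b)` (`eq_of_double_limits`). This interchange is used twice: it makes `d_pφ` continuous on the space
of `φ.tilde`-types (`exists_continuous_limit`), and, applied to `U` and `V`, it is the symmetry
`d_pφ^q = d_qφ.tilde^p`. -/

def BVar.inl {S : Type u} {Δ : List S} : {Γ : List S} → {s : S} → BVar Γ s → BVar (Γ ++ Δ) s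
  | _, _, .zero => .zero
  | _, _, .succ v => .succ v.inl

/-- The new variables `Δ` sit to the right of `Γ`, so that `(s :: Γ) ++ Δ` reduces to `s :: (Γ ++
Δ)` and substitution passes under quantifiers without casts. -/
def BVar.inr {S : Type u} {Δ : List S} : (Γ : List S) → {s : S} → BVar Δ s → BVar (Γ ++ Δ) s
  | [], _, v => v
  | _ :: Γ, _, v => .succ (BVar.inr Γ v)

/-- Concatenation of assignments of the bound variables. -/
def Env.append {M : Struct L} {Δ : List L.Srt} (d : Env M Δ) :
    {Γ : List L.Srt} → Env M Γ → Env M (Γ ++ Δ)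
  | [], _ => d
  | _ :: _, e => Env.cons (e _ .zero) (Env.append d (fun _ v => e _ (.succ v)))

theorem Env.append_inl {M : Struct L} {Δ : List L.Srt} (d : Env M Δ) {Γ : List L.Srt}
    (e : Env M Γ) {s : L.Srt} (v : BVar Γ s) : Env.append d e s v.inl = e s v := by
  induction v with
  | zero => rfl
  | succ v ih => exact ih (fun _ v => e _ (.succ v))

theorem Env.append_inr {M : Struct L} {Δ : List L.Srt} (d : Env M Δ) {Γ : List L.Srt}
    (e : Env M Γ) {s : L.Srt} (v : BVar Δ s) : Env.append d e s (BVar.inr Γ v) = d s v := by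
  induction Γ with
  | nil => rfl
  | cons t Γ ih => exact ih (fun _ v => e _ (.succ v))

variable {X P : L.Srt → Type*} {Δ : List L.Srt}

/-- Turn the free variables from `X` into bound variables of `Δ`. -/
def Term.bind (β : ∀ s, X s → BVar Δ s) {Γ : List L.Srt} :
    {s : L.Srt} → Term L (fun s => X s ⊕ P s) Γ s → Term L P (Γ ++ Δ) s
  | _, .fvar (.inl x) => .bvar (BVar.inr Γ (β _ x))
  | _, .fvar (.inr m) => .fvar m
  | _, .bvar v => .bvar v.inl
  | _, .app f ts => .app f (fun i => (ts i).bind β)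

/-- Turn the free variables from `X` into bound variables of `Δ`. -/
def Formula.bind (β : ∀ s, X s → BVar Δ s) :
    {Γ : List L.Srt} → Formula L F (fun s => X s ⊕ P s) Γ → Formula L F P (Γ ++ Δ)
  | _, .atom Q ts => .atom Q (fun i => (ts i).bind β)
  | _, .conn c hc ψ => .conn c hc (fun i => (ψ i).bind β)
  | _, .inf s ψ => .inf s (ψ.bind β)
  | _, .sup s ψ => .sup s (ψ.bind β)

theorem Term.eval_bind (β : ∀ s, X s → BVar Δ s) (M : Struct L) (m : Tuple P M) (d : Env M Δ)
    {Γ : List L.Srt} (e : Env M Γ) {s : L.Srt} (t : Term L (fun s => X s ⊕ P s) Γ s) :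
    (t.bind β).eval M m (Env.append d e) =
      t.eval M (fun s => Sum.elim (fun x => d s (β s x)) (m s)) e := by
  induction t with
  | fvar v =>
    cases v with
    | inl x => exact Env.append_inr d e _
    | inr m => rfl
  | bvar v => exact Env.append_inl d e v
  | app f ts ih => exact congrArg (M.func f) (funext ih)

theorem Formula.eval_bind (β : ∀ s, X s → BVar Δ s) (M : Struct L) (m : Tuple P M) (d : Env M Δ)
    {Γ : List L.Srt} (ψ : Formula L F (fun s => X s ⊕ P s) Γ) (e : Env M Γ) :
    (ψ.bind β).eval M m (Env.append d e) =
      ψ.eval M (fun s => Sum.elim (fun x => d s (β s x)) (m s)) e := by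
  induction ψ with
  | atom Q ts => exact congrArg (M.pred Q) (funext fun i => Term.eval_bind β M m d e (ts i))
  | conn c hc ψ ih => exact congrArg c (funext fun i => ih i e)
  | inf s ψ ih => exact iInf_congr fun b => ih (Env.cons b e)
  | sup s ψ ih => exact iSup_congr fun b => ih (Env.cons b e)

/-- Quantify all bound variables by `inf`. -/
def Formula.infClosure : (Δ : List L.Srt) → Formula L F P Δ → Formula L F P []
  | [], ψ => ψ
  | s :: Δ, ψ => Formula.infClosure Δ (.inf s ψ)

theorem Formula.value_infClosure_le (M : Struct L) (m : Tuple P M) (ψ : Formula L F P Δ)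
    (e : Env M Δ) : (ψ.infClosure Δ).value M m ≤ ψ.eval M m e := by
  induction Δ with
  | nil =>
    have : e = Env.nil M := by funext s v; cases v
    rw [this]; rfl
  | cons s Δ ih =>
    refine (ih (.inf s ψ) (fun _ v => e _ (.succ v))).trans ?_
    have : e = Env.cons (e _ .zero) (fun _ v => e _ (.succ v)) := by
      funext s v; cases v <;> rfl
    conv_rhs => rw [this]
    exact iInf_le _ _

theorem Formula.exists_eval_lt_of_value_infClosure_lt (M : Struct L) (m : Tuple P M)
    (ψ : Formula L F P Δ) {r : unitInterval} (h : (ψ.infClosure Δ).value M m < r) :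
    ∃ e : Env M Δ, ψ.eval M m e < r := by
  induction Δ with
  | nil => exact ⟨_, h⟩
  | cons s Δ ih =>
    obtain ⟨e, he⟩ := ih (.inf s ψ) h
    obtain ⟨b, hb⟩ := iInf_lt_iff.1 he
    exact ⟨_, hb⟩

/-- The positions `β` are chosen before the structure: the same quantified formula has to be read in
`M` and in its extension. -/
theorem exists_bvar_assignment (l : List (Σ s, X s)) :
    ∃ β : ∀ s x, (⟨s, x⟩ : Σ s, X s) ∈ l → BVar (l.map Sigma.fst) s,
      ∀ (M : Struct L) (a : Tuple X M), ∃ e : Env M (l.map Sigma.fst),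
        ∀ s x h, e s (β s x h) = a s x := by
  classical
  induction l with
  | nil => exact ⟨fun _ _ h => absurd h List.not_mem_nil,
      fun M _ => ⟨Env.nil M, fun _ _ h => absurd h List.not_mem_nil⟩⟩
  | cons y l ih =>
    obtain ⟨β, hβ⟩ := ih
    have key : ∀ s x, (⟨s, x⟩ : Σ s, X s) ∈ y :: l →
        ∃ v : BVar ((y :: l).map Sigma.fst) s, ∀ (M : Struct L) (a : Tuple X M)
          (e : Env M (l.map Sigma.fst)), (∀ s x h, e s (β s x h) = a s x) →
          Env.cons (a y.1 y.2) e s v = a s x := by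
      intro s x h
      by_cases hx : (⟨s, x⟩ : Σ s, X s) = y
      · subst hx
        exact ⟨.zero, fun _ _ _ _ => rfl⟩
      · exact ⟨.succ (β s x ((List.mem_cons.1 h).resolve_left hx)), fun M a e he => he _ _ _⟩
    choose v hv using key
    refine ⟨v, fun M a => ?_⟩
    obtain ⟨e, he⟩ := hβ M a
    exact ⟨_, fun s x h => hv s x h M a e he⟩

/-- A condition `ψ < r` with parameters in `M` that is satisfied in an elementary extension is
satisfied in `M`. -/
theorem ElemEmbedding.exists_value_lt {X : L.Srt → Type} [Finite (Σ s, X s)] {M N : Struct L}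
    (j : ElemEmbedding F M N) (a : Tuple X N) (ψ : Formula L F (VarsAndParams X M) [])
    {r : unitInterval} (h : tpFun j a ψ < r) :
    ∃ a' : Tuple X M, tpFun (ElemEmbedding.refl F M) a' ψ < r := by
  have := Fintype.ofFinite (Σ s, X s)
  obtain ⟨β, hβ⟩ := exists_bvar_assignment (L := L) (Finset.univ : Finset (Σ s, X s)).toList
  have hm : ∀ y : Σ s, X s, y ∈ (Finset.univ : Finset (Σ s, X s)).toList := by simp
  let γ := fun s x => β s x (hm ⟨s, x⟩)
  -- `θ` is `inf_x ψ`, a formula over `M` alone, so elementarity carries its value from `N` to `M`.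
  let θ : Formula L F M.carrier [] := (ψ.bind γ).infClosure _
  have hN : θ.value N (fun s => j.toFun s) < r := by
    obtain ⟨e, he⟩ := hβ N a
    refine (Formula.value_infClosure_le N _ (ψ.bind γ) e).trans_lt ?_
    have := Formula.eval_bind γ N (fun s => j.toFun s) e ψ (Env.nil N)
    refine (this.trans ?_).trans_lt h
    simp only [γ, he]
    rfl
  have hM : θ.value M (fun _ m => m) < r := by
    rwa [← j.map_value M.carrier θ (fun _ m => m)]
  obtain ⟨e, he⟩ := Formula.exists_eval_lt_of_value_infClosure_lt M _ (ψ.bind γ) hM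
  have := Formula.eval_bind γ M (fun _ m => m) e ψ (Env.nil M)
  exact ⟨fun s x => e s (γ s x), this.symm.trans_lt he⟩

theorem ConnectiveSystem.Generates.exists_formula {n : ℕ}
    {c : C(Fin n → unitInterval, unitInterval)} (hc : F.Generates n c) {V : L.Srt → Type*}
    {Γ : List L.Srt} (ψ : Fin n → Formula L F V Γ) :
    ∃ θ : Formula L F V Γ, ∀ (M : Struct L) (a : Tuple V M) (e : Env M Γ),
      θ.eval M a e = c (fun i => (ψ i).eval M a e) := by
  induction hc with
  | base hc => exact ⟨.conn _ hc ψ, fun _ _ _ => rfl⟩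
  | proj i => exact ⟨ψ i, fun _ _ _ => rfl⟩
  | comp _ _ ihc ihg =>
    choose χ hχ using fun i => ihg i ψ
    obtain ⟨θ, hθ⟩ := ihc χ
    refine ⟨θ, fun M a e => ?_⟩
    rw [hθ]
    simp only [hχ]
    rfl

theorem denseRange_tpSelf (hF : F.IsFull) (X : L.Srt → Type) [Finite (Σ s, X s)] (M : Struct L) :
    DenseRange (tpSelf F : Tuple X M → TypeOver F X M) := by
  intro r
  let val : TypeOver F X M → Formula L F (VarsAndParams X M) [] → unitInterval := fun r => r.1
  have hind : IsInducing val := ⟨rfl⟩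
  obtain ⟨N, j, a, hr⟩ : ∃ (N : Struct L) (j : ElemEmbedding F M N) (a : Tuple X N),
      val r = tpFun j a := r.2
  rw [hind.closure_eq_preimage_closure_image, Set.mem_preimage, hr, mem_closure_iff]
  intro O hO hmem
  obtain ⟨I, u, hu, hsub⟩ := isOpen_pi_iff.1 hO _ hmem
  suffices ∃ a' : Tuple X M, ∀ ψ ∈ I, tpFun (ElemEmbedding.refl F M) a' ψ ∈ u ψ by
    obtain ⟨a', ha'⟩ := this
    exact ⟨_, hsub ha', _, ⟨a', rfl⟩, rfl⟩
  -- Fullness only speaks of connectives of positive arity.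
  rcases I.eq_empty_or_nonempty with rfl | hI
  · have := M.nonempty
    exact ⟨fun _ _ => Classical.ofNonempty, by simp⟩
  let g : Fin I.card → Formula L F (VarsAndParams X M) [] := fun i => (I.equivFin.symm i).1
  let t : Fin I.card → unitInterval := fun i => tpFun j a (g i)
  have hopen : IsOpen (Set.univ.pi fun i => u (g i)) :=
    isOpen_set_pi Set.finite_univ fun i _ => (hu _ (I.equivFin.symm i).2).1
  obtain ⟨ε, hε, hball⟩ := Metric.isOpen_iff.1 hopen t
    (fun i _ => (hu _ (I.equivFin.symm i).2).2)
  -- The sup distance to the target values `t` merges the finitely many conditions into one. A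
  -- generated connective `c'` within `ε/4` of it gives a genuine formula `θ`; `θ < ε/4` at a tuple
  -- then forces distance below `ε/2`.
  let c : C(Fin I.card → unitInterval, unitInterval) :=
    ⟨fun s => ⟨dist s t, dist_nonneg, (dist_pi_le_iff zero_le_one).2 fun i => by
        rw [Subtype.dist_eq, Real.dist_eq, abs_le]
        have h1 := (s i).2
        have h2 := (t i).2
        constructor <;> linarith [h1.1, h1.2, h2.1, h2.2]⟩, by fun_prop⟩
  obtain ⟨c', hc', hcc⟩ := (hF I.card hI.card_pos).exists_dist_lt c (half_pos (half_pos hε))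
  obtain ⟨θ, hθ⟩ := ConnectiveSystem.Generates.exists_formula (L := L) hc' g
  have hd : ∀ s, |dist s t - (c' s : ℝ)| < ε / 2 / 2 := fun s =>
    (ContinuousMap.dist_apply_le_dist (f := c) (g := c') s).trans_lt hcc
  have hlt : (tpFun j a θ : ℝ) < ε / 2 / 2 := by
    have h1 := hd t
    rw [dist_self, zero_sub, abs_neg] at h1
    have : tpFun j a θ = c' t := hθ N _ _
    rw [this]
    exact (le_abs_self _).trans_lt h1
  obtain ⟨a', ha'⟩ : ∃ a' : Tuple X M,
      (tpFun (ElemEmbedding.refl F M) a' θ : ℝ) < ε / 2 / 2 := by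
    -- If `ε/4 > 1`, the bound is not in `[0,1]`, but then every tuple satisfies it.
    by_cases h1 : ε / 2 / 2 ≤ 1
    · exact j.exists_value_lt a θ (r := ⟨_, (half_pos (half_pos hε)).le, h1⟩) hlt
    · have := M.nonempty
      exact ⟨fun _ _ => Classical.ofNonempty, lt_of_le_of_lt unitInterval.le_one' (not_le.1 h1)⟩
  refine ⟨a', fun ψ hψ => ?_⟩
  let s : Fin I.card → unitInterval := fun i => tpFun (ElemEmbedding.refl F M) a' (g i)
  have hs : tpFun (ElemEmbedding.refl F M) a' θ = c' s := hθ M _ _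
  rw [hs] at ha'
  have hst : dist s t < ε := by linarith [(abs_lt.1 (hd s)).2]
  have := hball hst (I.equivFin ⟨ψ, hψ⟩) trivial
  simpa [s, g] using this

end Density

/-! ### Double limits -/

section DoubleLimit

variable {A B : Type*}

/-- Interchange of limits for a function without order property. -/
theorem eq_of_double_limits (φ : A → B → unitInterval)
    (hφ : ∀ ε : ℝ, 0 < ε → ¬ ∃ (a : ℕ → A) (b : ℕ → B), ∀ i j, i < j →
      ε ≤ |(φ (a i) (b j) : ℝ) - (φ (a j) (b i) : ℝ)|)
    {U : Filter A} {V : Filter B} [U.NeBot] [V.NeBot] {f : B → unitInterval} {g : A → unitInterval}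
    (hf : ∀ b, Tendsto (fun a => φ a b) U (𝓝 (f b)))
    (hg : ∀ a, Tendsto (φ a) V (𝓝 (g a))) {r s : unitInterval}
    (hr : Tendsto f V (𝓝 r)) (hs : Tendsto g U (𝓝 s)) : r = s := by
  by_contra hne
  have hpos : 0 < dist r s := dist_pos.2 hne
  -- Going from `r` to `s` costs four approximation errors below `ε`, which leaves more than `ε` for
  -- the gap between `φ (a i) (b j)` and `φ (a j) (b i)`.
  set ε := dist r s / 5 with hε
  have hε0 : 0 < ε := by positivity
  -- The next pair is generic over all earlier ones. Its two entries are chosen independently, since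
  -- nothing is asked of `φ` at the pair itself.
  have step : ∀ l : List (A × B), ∃ z : A × B, dist (f z.2) r < ε ∧ dist (g z.1) s < ε ∧
      ∀ y ∈ l, dist (φ z.1 y.2) (f y.2) < ε ∧ dist (φ y.1 z.2) (g y.1) < ε := by
    intro l
    have h1 : ∀ᶠ a in U, ∀ y ∈ l, dist (φ a y.2) (f y.2) < ε :=
      (eventually_all_finite l.finite_toSet).2 fun y _ => Metric.tendsto_nhds.1 (hf y.2) ε hε0
    have h2 : ∀ᶠ b in V, ∀ y ∈ l, dist (φ y.1 b) (g y.1) < ε :=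
      (eventually_all_finite l.finite_toSet).2 fun y _ => Metric.tendsto_nhds.1 (hg y.1) ε hε0
    obtain ⟨a, ha1, ha2⟩ := (h1.and (Metric.tendsto_nhds.1 hs ε hε0)).exists
    obtain ⟨b, hb1, hb2⟩ := (h2.and (Metric.tendsto_nhds.1 hr ε hε0)).exists
    exact ⟨(a, b), hb2, ha2, fun y hy => ⟨ha1 y hy, hb1 y hy⟩⟩
  choose z hz1 hz2 hz3 using step
  let l : ℕ → List (A × B) := fun n => Nat.rec [] (fun _ l => z l :: l) n
  have hl : ∀ i j, i < j → z (l i) ∈ l j := by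
    intro i j hij
    induction j, hij using Nat.le_induction with
    | base => exact List.mem_cons_self
    | succ j _ ih => exact List.mem_cons_of_mem _ ih
  refine hφ ε hε0 ⟨fun i => (z (l i)).1, fun i => (z (l i)).2, fun i j hij => ?_⟩
  obtain ⟨h1, h2⟩ := hz3 (l j) _ (hl i j hij)
  have h3 := hz1 (l i)
  have h4 := hz2 (l i)
  rw [← Real.dist_eq, ← Subtype.dist_eq]
  rw [dist_comm] at h1 h3
  have t1 := dist_triangle4 r (f (z (l i)).2) (φ (z (l j)).1 (z (l i)).2)
    (φ (z (l i)).1 (z (l j)).2)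
  have t2 := dist_triangle4 r (φ (z (l i)).1 (z (l j)).2) (g (z (l i)).1) s
  rw [dist_comm (φ (z (l j)).1 (z (l i)).2)] at t1
  linarith

/-- Limits along `U` of the points of a space `S` of functions on `A` depend continuously on the
point, if the functions `φ · b` are dense in `S` and `φ` has no order property. -/
theorem exists_continuous_limit {S : Type*} [TopologicalSpace S] (φ : A → B → unitInterval)
    (hφ : ∀ ε : ℝ, 0 < ε → ¬ ∃ (a : ℕ → A) (b : ℕ → B), ∀ i j, i < j →
      ε ≤ |(φ (a i) (b j) : ℝ) - (φ (a j) (b i) : ℝ)|)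
    (ev : S → A → unitInterval) (hev : Continuous ev)
    (hdense : ∀ s, ev s ∈ closure (Set.range fun b a => φ a b)) (U : Ultrafilter A) :
    ∃ D : C(S, unitInterval), ∀ s, Tendsto (ev s) U (𝓝 (D s)) := by
  have hlim : ∀ k : A → unitInterval, ∃ r, Tendsto k U (𝓝 r) := fun k => by
    obtain ⟨r, -, hr⟩ := isCompact_univ.ultrafilter_le_nhds (U.map k) (by simp)
    exact ⟨r, hr⟩
  choose lim hlim using hlim
  let Φ : B → A → unitInterval := fun b a => φ a b
  let f : B → unitInterval := fun b => lim (Φ b)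
  -- Here stability enters: as `φ · b` approaches `ev s` pointwise, its `U`-limit approaches that of
  -- `ev s`. Along an ultrafilter the limit exists by compactness, and the interchange identifies
  -- it.
  have hf : ∀ s, Tendsto f (comap Φ (𝓝 (ev s))) (𝓝 (lim (ev s))) := by
    intro s
    rw [tendsto_iff_ultrafilter]
    intro V hV
    obtain ⟨r, -, hr⟩ := isCompact_univ.ultrafilter_le_nhds (V.map f) (by simp)
    have hg : Tendsto Φ V (𝓝 (ev s)) := tendsto_comap.mono_left hV
    have := eq_of_double_limits φ hφ (U := U) (V := V) (f := f) (g := ev s)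
      (fun b => hlim (Φ b)) (fun a => (tendsto_pi_nhds.1 hg) a) hr (hlim _)
    exact this ▸ hr
  refine ⟨⟨fun s => lim (ev s), continuous_iff_continuousAt.2 fun s => ?_⟩, fun s => hlim _⟩
  -- Extension by continuity into a regular space: `f` maps into the closed set `C` near `ev s`, and
  -- by density the value at any nearby `s'` is a limit of such values of `f`.
  refine (closed_nhds_basis (lim (ev s))).tendsto_right_iff.2 fun C ⟨hC, hCc⟩ => ?_
  obtain ⟨O, hO, hOC⟩ := mem_comap.1 (hf s hC)
  filter_upwards [hev.continuousAt (eventually_mem_nhds_iff.2 hO)] with s' hs'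
  have : (comap Φ (𝓝 (ev s'))).NeBot := comap_neBot_iff_frequently.2 (mem_closure_iff_frequently.1 (hdense s'))
  exact hCc.mem_of_tendsto (hf s') (mem_comap.2 ⟨O, hs', hOC⟩)

end DoubleLimit

/-! ### Local types -/

section LocalTypes

variable {L : Signature.{u}} {F : ConnectiveSystem}

theorem Term.eval_relabel {V W : L.Srt → Type*} (g : ∀ s, V s → W s) (M : Struct L)
    (a : Tuple W M) {Γ : List L.Srt} (e : Env M Γ) {s : L.Srt} (t : Term L V Γ s) :
    (t.relabel g).eval M a e = t.eval M (fun s v => a s (g s v)) e := by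
  induction t with
  | fvar v => rfl
  | bvar v => rfl
  | app f ts ih => exact congrArg (M.func f) (funext ih)

theorem Formula.eval_relabel {V W : L.Srt → Type*} (g : ∀ s, V s → W s) (M : Struct L)
    (a : Tuple W M) {Γ : List L.Srt} (ψ : Formula L F V Γ) (e : Env M Γ) :
    (ψ.relabel g).eval M a e = ψ.eval M (fun s v => a s (g s v)) e := by
  induction ψ with
  | atom Q ts => exact congrArg (M.pred Q) (funext fun i => Term.eval_relabel g M a e (ts i))
  | conn c hc ψ ih => exact congrArg c (funext fun i => ih i e)
  | inf s ψ ih => exact iInf_congr fun b => ih (Env.cons b e)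
  | sup s ψ ih => exact iSup_congr fun b => ih (Env.cons b e)

namespace SplitFormula

variable {X Y : L.Srt → Type}

theorem value₂_tilde (φ : SplitFormula L F X Y) (M : Struct L) (a : Tuple X M) (b : Tuple Y M) :
    φ.tilde.value₂ M b a = φ.value₂ M a b := by
  refine (Formula.eval_relabel _ M _ φ _).trans (congrArg (fun c => Formula.value φ M c) ?_)
  funext s v
  cases v <;> rfl

theorem tpSelf_inst (φ : SplitFormula L F X Y) (M : Struct L) (a : Tuple X M) (b : Tuple Y M) :
    (tpSelf F a).1 (φ.inst b) = φ.value₂ M a b := by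
  refine (Formula.eval_relabel _ M _ φ _).trans (congrArg (fun c => Formula.value φ M c) ?_)
  funext s v
  cases v <;> rfl

theorem PhiType.continuous_value (φ : SplitFormula L F X Y) (M : Struct L) :
    Continuous (PhiType.value : φ.PhiType M → Tuple Y M → unitInterval) := by
  refine continuous_pi fun b => Continuous.quotient_lift (s := φ.phiSetoid M) ?_ _
  exact (continuous_apply (φ.inst b)).comp continuous_induced_dom

theorem PhiType.value_mem_closure (hF : F.IsFull) [Finite (Σ s, X s)]
    (φ : SplitFormula L F X Y) (M : Struct L) (p : φ.PhiType M) :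
    p.value ∈ closure (Set.range fun a b => φ.value₂ M a b) := by
  induction p using Quotient.inductionOn with
  | h r =>
    have h : Continuous fun r => PhiType.value (φ.toPhiType M r) :=
      (PhiType.continuous_value φ M).comp (φ.toPhiType M).continuous
    refine map_mem_closure (f := fun r => PhiType.value (φ.toPhiType M r)) h (denseRange_tpSelf hF X M r) ?_
    rintro _ ⟨a, rfl⟩
    exact ⟨a, funext fun b => (tpSelf_inst φ M a b).symm⟩

/-- Density gives a proper filter converging to `p`; it is refined to an ultrafilter so that every
`[0,1]`-valued function on tuples has a limit along it. -/
theorem PhiType.exists_ultrafilter (hF : F.IsFull) [Finite (Σ s, X s)]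
    (φ : SplitFormula L F X Y) (M : Struct L) (p : φ.PhiType M) :
    ∃ U : Ultrafilter (Tuple X M), ∀ b, Tendsto (fun a => φ.value₂ M a b) U (𝓝 (p.value b)) := by
  have : (comap (fun a b => φ.value₂ M a b) (𝓝 p.value)).NeBot :=
    comap_neBot_iff_frequently.2
      (mem_closure_iff_frequently.1 (PhiType.value_mem_closure hF φ M p))
  exact ⟨Ultrafilter.of _,
    tendsto_pi_nhds.1 (tendsto_comap.mono_left (Ultrafilter.of_le _))⟩

theorem IsDefinition.unique (hF : F.IsFull) [Finite (Σ s, Y s)] {φ : SplitFormula L F X Y}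
    {M : Struct L} {p : φ.PhiType M} {ψ χ : DefPredicate F Y M} (hψ : IsDefinition p ψ)
    (hχ : IsDefinition p χ) : ψ = χ :=
  DFunLike.coe_injective <| (denseRange_tpSelf hF Y M).equalizer ψ.continuous χ.continuous <|
    funext fun b => (hψ b).symm.trans (hχ b)

end SplitFormula

end LocalTypes

end ContLogic

open ContLogic in
theorem mainTheorem7 (L : Signature.{u}) (F : ConnectiveSystem) (hF : F.IsFull)
    (T : Theory L F) (X Y : L.Srt → Type) [Finite (Σ s, X s)] [Finite (Σ s, Y s)]
    (φ : SplitFormula L F X Y) (hφ : φ.IsStable T) (M : Struct L) (hM : IsModel M T)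
    (p : φ.PhiType M) (q : φ.tilde.PhiType M) :
    ∃ (dp : φ.tilde.PhiPredicate M) (dq : φ.PhiPredicate M),
      (SplitFormula.IsDefinition p dp.toDefPredicate ∧
        ∀ ψ : DefPredicate F Y M, SplitFormula.IsDefinition p ψ → ψ = dp.toDefPredicate) ∧
      (SplitFormula.IsDefinition q dq.toDefPredicate ∧
        ∀ ψ : DefPredicate F X M, SplitFormula.IsDefinition q ψ → ψ = dq.toDefPredicate) ∧
      dp q = dq p := by
  open SplitFormula Filter Topology in
  have hst : ∀ ε : ℝ, 0 < ε → ¬ ∃ (a : ℕ → Tuple X M) (b : ℕ → Tuple Y M), ∀ i j, i < j →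
      ε ≤ |(φ.value₂ M (a i) (b j) : ℝ) - (φ.value₂ M (a j) (b i) : ℝ)| :=
    fun ε hε => hφ ε hε M hM
  have hst' : ∀ ε : ℝ, 0 < ε → ¬ ∃ (b : ℕ → Tuple Y M) (a : ℕ → Tuple X M), ∀ i j, i < j →
      ε ≤ |(φ.tilde.value₂ M (b i) (a j) : ℝ) - (φ.tilde.value₂ M (b j) (a i) : ℝ)| := by
    rintro ε hε ⟨b, a, h⟩
    refine hst ε hε ⟨a, b, fun i j hij => ?_⟩
    simpa only [value₂_tilde, abs_sub_comm] using h i j hij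
  obtain ⟨U, hU⟩ := PhiType.exists_ultrafilter hF φ M p
  obtain ⟨V, hV⟩ := PhiType.exists_ultrafilter hF φ.tilde M q
  simp only [value₂_tilde] at hV
  obtain ⟨dp, hdp⟩ := exists_continuous_limit (φ.value₂ M) hst
    (PhiType.value : φ.tilde.PhiType M → _) (PhiType.continuous_value _ M)
    (fun s => by simpa only [value₂_tilde] using PhiType.value_mem_closure hF φ.tilde M s) U
  obtain ⟨dq, hdq⟩ := exists_continuous_limit (φ.tilde.value₂ M) hst'
    (PhiType.value : φ.PhiType M → _) (PhiType.continuous_value _ M)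
    (fun s => by simpa only [value₂_tilde] using PhiType.value_mem_closure hF φ M s) V
  have hp : IsDefinition p (PhiPredicate.toDefPredicate dp) := fun b => by
    -- At the type of `b`, both sides are the `U`-limit of `φ(a, b)`.
    refine tendsto_nhds_unique (hU b) ((hdp (φ.tilde.toPhiType M (tpSelf F b))).congr fun a => ?_)
    exact (tpSelf_inst φ.tilde M b a).trans (value₂_tilde φ M a b)
  have hq : IsDefinition q (PhiPredicate.toDefPredicate dq) := fun a => by
    refine tendsto_nhds_unique (hV a) ((hdq (φ.toPhiType M (tpSelf F a))).congr fun b => ?_)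
    exact tpSelf_inst φ M a b
  refine ⟨dp, dq, ⟨hp, fun ψ hψ => hψ.unique hF hp⟩, ⟨hq, fun ψ hψ => hψ.unique hF hq⟩, ?_⟩
  -- The inner limits are `φ(x, b)^p` along `U` and `φ(a, y)^q` along `V`; the outer ones are `dq p`
  -- and `dp q`.
  exact (eq_of_double_limits (φ.value₂ M) hst hU hV (hdq p) (hdp q)).symm
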